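/- **Corollary 5 (fiber products for the second derivative trace test).** Let $0\le D\le n$, $m\ge 0$, $r\ge 1$, and let $f(x;p)=(f_1,\dots,f_{n-D})$ be polynomials in $x\in\mathbb C^n$ and $p\in\mathbb C^m$. Let $A\subset V(f(x,p))\subset\mathbb C^n\times\mathbb C^m$ be an irreducible algebraic set. A constant $c$ consists of the coefficients of an affine linear map $L_c:\mathbb C^n\to\mathbb C^D$ and of a vector $\alpha_c\in\mathbb C^n$. For unknowns $z=(x_i,\dot x_i,\ddot x_i)_{i=1}^r\in(\mathbb C^n)^{3r}$, let $F_c(z,p)$ be the component system consisting, for $i=1,\dots,r$, of $$f(x_i;p),\qquad L_c(x_i),\qquad \begin{bmatrix}Jf(x_i;p)\\ JL_c(x_i)\end{bmatrix}\dot x_i-\begin{bmatrix}0\\ \mathbf 1\end{bmatrix},\qquad \begin{bmatrix}Jf(x_i;p)\\ JL_c(x_i)\end{bmatrix}\ddot x_i+\begin{bmatrix}\dot x_i^T\,\mathrm{Hessian}(f_1)(x_i;p)\,\dot x_i\\ \vdots\\ \dot x_i^T\,\mathrm{Hessian}(f_{n-D})(x_i;p)\,\dot x_i\\ 0\end{bmatrix},$$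 together with the single trace condition $\alpha_c\cdot(\ddot x_1+\cdots+\ddot x_r)$. Here $J$ and Hessian are taken with respect to $x$, and $\mathbf 1=(1,\dots,1)\in\mathbb C^D$. For $a\ge 0$ and constants $c_1,\dots,c_a$ let $\mathcal F_a(z_1,\dots,z_a,p)=[F_{c_1}(z_1,p);\dots;F_{c_a}(z_a,p)]$ and $\pi_a(z_1,\dots,z_a,p)=p$. Let $V_A(\mathcal F_a)$ be the set of solutions of $\mathcal F_a$ for which every point $x$ among the $ar$ points $x_i$ satisfies $(x,p)\in A$. Let $\Delta_a$ ($a\ge0$) be sets to ignore, chosen consistently: each $\Delta_a$ is an algebraic set of points $(c_1,\dots,c_a,z_1,\dots,z_a,p)$, and we also write $\Delta_a$ for its part over given constants. If $(z_1,\dots,z_b,p)\in V_A(\mathcal F_b)$ and the part of this solution belonging to $a\le b$ of the component systems (in their order) lies in $\Delta_a$, then the whole solution lies in $\Delta_b$. Conversely, a point of $V_A(\mathcal F_a)\cap\Delta_a$ with $a\ge2$ has a block $(z_j,p)$ that lies in $\Delta_1$ or, when $D\ge1$, two different blocks $z_j,z_{j'}$ with a point $x_i$ in common. (For example, when $D\ge1$,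 $\Delta_a$ may be the set of all points with $z_j=z_{j'}$ for some $j\ne j'$.) Then Theorem 1 holds for this component system, that is: for every $a\ge 0$ there is a value $d_a$ such that $$\dim\overline{\pi_a(V_A(\mathcal F_a)\setminus\Delta_a)}=d_a$$ for all $(c_1,\dots,c_a)$ outside a proper algebraic subset of the space of constants (Zariski closure in $\mathbb C^m$; the empty set has dimension $-\infty$), and for every $a\ge0$ exactly one of the following holds: 1. $d_a>d_{a+1}$; 2. $d_a=d_j$ for all $j\ge a$. -/

import Mathlib

open MvPolynomial

noncomputable section

namespace TraceTest

/-! ### Algebraic sets in affine space over `ℂ` -/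

/-- A Zariski-closed subset of `ℂ^σ`. -/
def IsAlgebraicSet {σ : Type} (S : Set (σ → ℂ)) : Prop :=
  ∃ I : Ideal (MvPolynomial σ ℂ), S = zeroLocus ℂ I

/-- An irreducible algebraic set: closed, nonempty, and not covered by two algebraic sets unless
one of them already covers it. -/
def IsIrreducibleAlgebraicSet {σ : Type} (A : Set (σ → ℂ)) : Prop :=
  IsAlgebraicSet A ∧ A.Nonempty ∧
    ∀ X Y : Set (σ → ℂ), IsAlgebraicSet X → IsAlgebraicSet Y → A ⊆ X ∪ Y → A ⊆ X ∨ A ⊆ Y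

/-- The Zariski closure of a subset of `ℂ^σ`. -/
def zariskiClosure {σ : Type} (S : Set (σ → ℂ)) : Set (σ → ℂ) :=
  zeroLocus ℂ (vanishingIdeal ℂ S)

/-- The dimension of an algebraic set: the Krull dimension of its coordinate ring. The empty set
has dimension `⊥`. -/
def algDim {σ : Type} (X : Set (σ → ℂ)) : WithBot ℕ∞ :=
  ringKrullDim (MvPolynomial σ ℂ ⧸ vanishingIdeal ℂ X)

/-- `P` holds at generic points of `ℂ^σ`: its exceptions lie in a proper algebraic subset. -/
def Generically {σ : Type} (P : (σ → ℂ) → Prop) : Prop :=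
  ∃ E : Set (σ → ℂ), IsAlgebraicSet E ∧ E ≠ Set.univ ∧ ∀ c, c ∉ E → P c

/-- The common zeros in `ℂ^σ` of a family of polynomials. -/
def solutionSet {σ ι : Type} (g : ι → MvPolynomial σ ℂ) : Set (σ → ℂ) :=
  {v | ∀ e, eval v (g e) = 0}

/-! ### The component system

`n` variables `x`, `m` parameters `p`, slices of codimension `D`, and `r` witness points. -/

/-- Indices of the constants `c` of one component system: the matrix `B` and the vector `b` of the
slice `L_c(x) = B x + b`, then the vector `α_c`. -/
abbrev ConstIdx (n D : ℕ) : Type := (Fin D × Fin n) ⊕ Fin D ⊕ Fin n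

/-- The matrix `B` of the slice. -/
def sliceMatrix {n D : ℕ} (c : ConstIdx n D → ℂ) (i : Fin D) (l : Fin n) : ℂ := c (.inl (i, l))

/-- The vector `b` of the slice. -/
def sliceOffset {n D : ℕ} (c : ConstIdx n D → ℂ) (i : Fin D) : ℂ := c (.inr (.inl i))

/-- The vector `α_c` of the trace condition. -/
def traceVector {n D : ℕ} (c : ConstIdx n D → ℂ) (l : Fin n) : ℂ := c (.inr (.inr l))

/-- Indices of the unknowns of one component system: `(i, 0, l)`, `(i, 1, l)`, `(i, 2, l)` are the
`l`-th coordinates of `x_i`, `ẋ_i` and `ẍ_i`. -/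
abbrev BlockIdx (n r : ℕ) : Type := Fin r × Fin 3 × Fin n

/-- The slice `L_c`, as polynomials in `(x, p)` that do not involve `p`. -/
def slice {n D : ℕ} (m : ℕ) (c : ConstIdx n D → ℂ) (i : Fin D) :
    MvPolynomial (Fin n ⊕ Fin m) ℂ :=
  ∑ l, C (sliceMatrix c i l) * X (.inl l) + C (sliceOffset c i)

/-- The sliced system `[f; L_c]`, in the variables `(x, p)`. -/
def sliced {n m D : ℕ} (f : Fin (n - D) → MvPolynomial (Fin n ⊕ Fin m) ℂ) (c : ConstIdx n D → ℂ) :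
    Fin (n - D) ⊕ Fin D → MvPolynomial (Fin n ⊕ Fin m) ℂ :=
  Sum.elim f (slice m c)

/-- The polynomial `q(x_i, p)` in the unknowns of the component system and the parameters. -/
def atPoint {n m r : ℕ} (i : Fin r) (q : MvPolynomial (Fin n ⊕ Fin m) ℂ) :
    MvPolynomial (BlockIdx n r ⊕ Fin m) ℂ :=
  rename (Sum.map (fun l => (i, 0, l)) id) q

/-- The unknown `ẋ_i`, coordinate `l`. -/
def vel {n r : ℕ} (m : ℕ) (i : Fin r) (l : Fin n) : MvPolynomial (BlockIdx n r ⊕ Fin m) ℂ :=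
  X (.inl (i, 1, l))

/-- The unknown `ẍ_i`, coordinate `l`. -/
def acc {n r : ℕ} (m : ℕ) (i : Fin r) (l : Fin n) : MvPolynomial (BlockIdx n r ⊕ Fin m) ℂ :=
  X (.inl (i, 2, l))

/-- `J_x q (x_i, p) · v`, for one polynomial `q` and a vector `v`. -/
def jacobianRow {n m r : ℕ} (i : Fin r) (q : MvPolynomial (Fin n ⊕ Fin m) ℂ)
    (v : Fin n → MvPolynomial (BlockIdx n r ⊕ Fin m) ℂ) : MvPolynomial (BlockIdx n r ⊕ Fin m) ℂ :=
  ∑ l, atPoint i (pderiv (.inl l) q) * v l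

/-- `vᵀ · Hess_x q (x_i, p) · v`, for one polynomial `q` and a vector `v`. -/
def hessianForm {n m r : ℕ} (i : Fin r) (q : MvPolynomial (Fin n ⊕ Fin m) ℂ)
    (v : Fin n → MvPolynomial (BlockIdx n r ⊕ Fin m) ℂ) : MvPolynomial (BlockIdx n r ⊕ Fin m) ℂ :=
  ∑ l, ∑ l', v l * atPoint i (pderiv (.inl l) (pderiv (.inl l') q)) * v l'

/-- `[f(x_i; p); L_c(x_i)]`. -/
def pointEqs {n m D r : ℕ} (f : Fin (n - D) → MvPolynomial (Fin n ⊕ Fin m) ℂ)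
    (c : ConstIdx n D → ℂ) (i : Fin r) :
    Fin (n - D) ⊕ Fin D → MvPolynomial (BlockIdx n r ⊕ Fin m) ℂ :=
  fun e => atPoint i (sliced f c e)

/-- `[Jf(x_i; p); JL_c(x_i)] · ẋ_i - [0; 1]`. -/
def firstOrderEqs {n m D r : ℕ} (f : Fin (n - D) → MvPolynomial (Fin n ⊕ Fin m) ℂ)
    (c : ConstIdx n D → ℂ) (i : Fin r) :
    Fin (n - D) ⊕ Fin D → MvPolynomial (BlockIdx n r ⊕ Fin m) ℂ :=
  fun e => jacobianRow i (sliced f c e) (vel m i) - Sum.elim (fun _ => 0) (fun _ => 1) e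

/-- `[Jf(x_i; p); JL_c(x_i)] · ẍ_i + [ẋ_iᵀ · Hess(f_k)(x_i; p) · ẋ_i; 0]`. -/
def secondOrderEqs {n m D r : ℕ} (f : Fin (n - D) → MvPolynomial (Fin n ⊕ Fin m) ℂ)
    (c : ConstIdx n D → ℂ) (i : Fin r) :
    Fin (n - D) ⊕ Fin D → MvPolynomial (BlockIdx n r ⊕ Fin m) ℂ :=
  fun e => jacobianRow i (sliced f c e) (acc m i) +
    Sum.elim (fun k => hessianForm i (f k) (vel m i)) (fun _ => 0) e

/-- `α_c · (ẍ_1 + ⋯ + ẍ_r)`. -/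
def traceEq {n D : ℕ} (m r : ℕ) (c : ConstIdx n D → ℂ) : MvPolynomial (BlockIdx n r ⊕ Fin m) ℂ :=
  ∑ l, C (traceVector c l) * ∑ i, acc m i l

/-- Indices of the equations of one component system: four groups, the first three for each of the
`r` points. -/
abbrev EqIdx (n D r : ℕ) : Type :=
  (Fin r × (Fin (n - D) ⊕ Fin D)) ⊕ (Fin r × (Fin (n - D) ⊕ Fin D)) ⊕
    (Fin r × (Fin (n - D) ⊕ Fin D)) ⊕ Unit

/-- The component system `F_c` in the unknowns `x_i, ẋ_i, ẍ_i` (`i = 1, …, r`) and `p`. -/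
def componentSystem {n m D : ℕ} (r : ℕ) (f : Fin (n - D) → MvPolynomial (Fin n ⊕ Fin m) ℂ)
    (c : ConstIdx n D → ℂ) : EqIdx n D r → MvPolynomial (BlockIdx n r ⊕ Fin m) ℂ :=
  Sum.elim (fun ie => pointEqs f c ie.1 ie.2)
    (Sum.elim (fun ie => firstOrderEqs f c ie.1 ie.2)
      (Sum.elim (fun ie => secondOrderEqs f c ie.1 ie.2)
        (fun _ => traceEq m r c)))

/-! ### Fiber products -/

/-- Coordinates of `(z_1, …, z_a, p)`, where `z_j` stands for the unknowns of the `j`-th component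
system. -/
abbrev FiberIdx (n m r a : ℕ) : Type := (Fin a × BlockIdx n r) ⊕ Fin m

/-- The constants `c_j`. -/
def constAt {n D a : ℕ} (c : Fin a × ConstIdx n D → ℂ) (j : Fin a) : ConstIdx n D → ℂ :=
  fun s => c (j, s)

/-- The fiber product system `F_a(z_1, …, z_a, p) = [F_{c_1}(z_1, p); …; F_{c_a}(z_a, p)]`. -/
def fiberSystem {n m D : ℕ} (r : ℕ) (f : Fin (n - D) → MvPolynomial (Fin n ⊕ Fin m) ℂ) {a : ℕ}
    (c : Fin a × ConstIdx n D → ℂ) :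
    Fin a × EqIdx n D r → MvPolynomial (FiberIdx n m r a) ℂ :=
  fun je => rename (Sum.map (fun s => (je.1, s)) id) (componentSystem r f (constAt c je.1) je.2)

/-- The projection `π_a(z_1, …, z_a, p) = p`. -/
def toParam {n m r a : ℕ} (w : FiberIdx n m r a → ℂ) : Fin m → ℂ := fun q => w (.inr q)

/-- The `i`-th witness point of the `j`-th component system. -/
def witness {n m r a : ℕ} (w : FiberIdx n m r a → ℂ) (j : Fin a) (i : Fin r) : Fin n → ℂ :=
  fun l => w (.inl (j, i, 0, l))

/-- `V_A(F_a)`: the solutions of the fiber product system all of whose witness points `x` satisfy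
`(x, p) ∈ A`. -/
def fiberSolutions {n m D : ℕ} (r : ℕ) (f : Fin (n - D) → MvPolynomial (Fin n ⊕ Fin m) ℂ)
    (A : Set (Fin n ⊕ Fin m → ℂ)) {a : ℕ} (c : Fin a × ConstIdx n D → ℂ) :
    Set (FiberIdx n m r a → ℂ) :=
  {w | w ∈ solutionSet (fiberSystem r f c) ∧ ∀ j i, Sum.elim (witness w j i) (toParam w) ∈ A}

/-! ### Components to ignore -/

/-- Coordinates of `(c_1, …, c_a, z_1, …, z_a, p)`. -/
abbrev FamilyIdx (n m D r a : ℕ) : Type := (Fin a × ConstIdx n D) ⊕ FiberIdx n m r a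

/-- Keep only the constants of the component systems `e 0 < e 1 < ⋯`. -/
def selectConst {n D a b : ℕ} (e : Fin a ↪o Fin b) (c : Fin b × ConstIdx n D → ℂ) :
    Fin a × ConstIdx n D → ℂ :=
  fun s => c (e s.1, s.2)

/-- Keep only the unknowns of the component systems `e 0 < e 1 < ⋯`, and the parameters. -/
def selectFiber {n m r a b : ℕ} (e : Fin a ↪o Fin b) (w : FiberIdx n m r b → ℂ) :
    FiberIdx n m r a → ℂ :=
  Sum.elim (fun s => w (.inl (e s.1, s.2))) (toParam w)

/-- The embedding of a single component system, as the `j`-th of `a`. -/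
def single {a : ℕ} (j : Fin a) : Fin 1 ↪o Fin a :=
  OrderEmbedding.ofStrictMono (fun _ => j)
    (fun x y h => absurd h (by rw [Subsingleton.elim x y]; exact lt_irrefl y))

/-- The part of `Δ_a` over the constants `c`, a set of points `(z_1, …, z_a, p)`. -/
def ignoredAt {n m D r a : ℕ} (Δ : Set (FamilyIdx n m D r a → ℂ))
    (c : Fin a × ConstIdx n D → ℂ) : Set (FiberIdx n m r a → ℂ) :=
  {w | Sum.elim c w ∈ Δ}

/-- A consistent choice of sets `Δ_a` to ignore.
* Each `Δ_a` is algebraic (in the constants, the unknowns and the parameters).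
* `Δ_a` is included in `Δ_b`: a solution of the larger fiber product system is ignored as soon as
  the part of it belonging to some of the component systems is ignored.
* No further conditions come in when component systems are added, except on coincidences: an
  ignored solution of two or more component systems has a block that is ignored on its own or
  (for positive-dimensional slices) two different blocks with a witness point in common. -/
structure IsIgnorable {n m D r : ℕ} (f : Fin (n - D) → MvPolynomial (Fin n ⊕ Fin m) ℂ)
    (A : Set (Fin n ⊕ Fin m → ℂ)) (Δ : ∀ a : ℕ, Set (FamilyIdx n m D r a → ℂ)) : Prop where
  algebraic : ∀ a, IsAlgebraicSet (Δ a)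
  inclusion : ∀ (a b : ℕ) (e : Fin a ↪o Fin b) (c : Fin b × ConstIdx n D → ℂ),
    ∀ w ∈ fiberSolutions r f A c,
      selectFiber e w ∈ ignoredAt (Δ a) (selectConst e c) → w ∈ ignoredAt (Δ b) c
  consistent : ∀ a : ℕ, 2 ≤ a → ∀ c : Fin a × ConstIdx n D → ℂ,
    ∀ w ∈ fiberSolutions r f A c, w ∈ ignoredAt (Δ a) c →
      (∃ j, selectFiber (single j) w ∈ ignoredAt (Δ 1) (selectConst (single j) c)) ∨
      (0 < D ∧ ∃ j j' : Fin a, j ≠ j' ∧ ∃ i i' : Fin r, witness w j i = witness w j' i')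

/-- `dim` of the Zariski closure of `π_a(V_A(F_a) ∖ Δ_a)`. -/
def paramDim {n m D r : ℕ} (f : Fin (n - D) → MvPolynomial (Fin n ⊕ Fin m) ℂ)
    (A : Set (Fin n ⊕ Fin m → ℂ)) (Δ : ∀ a : ℕ, Set (FamilyIdx n m D r a → ℂ)) (a : ℕ)
    (c : Fin a × ConstIdx n D → ℂ) : WithBot ℕ∞ :=
  algDim (zariskiClosure (toParam '' (fiberSolutions r f A c \ ignoredAt (Δ a) c)))

end TraceTest

end

/-! Call a parameter persistent if it comes from a non-ignored solution of a single component system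
for a Zariski dense set of constants. The proof compares every `d a` with the dimension of the set
of persistent parameters.

Adding a component system only shrinks the set of surviving parameters, so the generic dimension
never increases. Suppose that it does not drop from `a` to `a + 1`, and fix generic values of as
many parameter coordinates as this dimension. For generic `c_1, …, c_a` only finitely many surviving
parameters take these values. A generic `c_{a+1}` kills every one of them that is not persistent,
yet one must survive; hence the persistent parameters are already dense over these coordinates
(`dominates_persistent`).

Conversely, a persistent parameter survives in the `j`-fold product for a dense set of constants
(`dense_of_mem_persistent`). Solutions over the same parameter can be put together block by block,
and the result could be ignored only because of a common witness point. This is prevented by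
choosing each new slice to miss the earlier points. So `d j` stays at least `d a` for all later `j`.

Dimensions are measured by sets of coordinates onto which the projection is dense (`le_algDim_iff`).
That they are constant for generic constants follows from Chevalley's theorem on the total space of
constants, unknowns and parameters (`coordProj_dichotomy`, `exists_generic_algDim`). -/

noncomputable section

namespace TraceTest

/-! ### Krull dimension and algebraically independent variables -/

/-- The Krull dimension of a finitely generated domain over a field is its transcendence degree. -/
theorem exists_ringKrullDim_eq_trdeg (k A : Type) [Field k] [CommRing A] [IsDomain A] [Algebra k A]
    [Algebra.FiniteType k A] :
    ∃ s : ℕ, ringKrullDim A = s ∧ Algebra.trdeg k A = s := by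
  obtain ⟨s, g, hinj, hint⟩ := exists_integral_inj_algHom_of_fg k A
  let : Algebra (MvPolynomial (Fin s) k) A := g.toRingHom.toAlgebra
  have hmap : algebraMap (MvPolynomial (Fin s) k) A = g.toRingHom := rfl
  have : IsScalarTower k (MvPolynomial (Fin s) k) A :=
    IsScalarTower.of_algebraMap_eq fun x => by rw [hmap]; exact (g.commutes x).symm
  have : Algebra.IsIntegral (MvPolynomial (Fin s) k) A := ⟨hint⟩
  have : FaithfulSMul (MvPolynomial (Fin s) k) A :=
    (faithfulSMul_iff_algebraMap_injective _ _).mpr hinj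
  refine ⟨s, ?_, ?_⟩
  · have hs : ringKrullDim (MvPolynomial (Fin s) k) = s := by
      rw [MvPolynomial.ringKrullDim_of_isNoetherianRing]; simp
    rw [← hs]
    apply le_antisymm
    -- Incomparability in the integral extension gives one inequality, going up the other.
    · exact Order.krullDim_le_of_strictMono
        (PrimeSpectrum.comap (algebraMap (MvPolynomial (Fin s) k) A))
        fun p q hpq => Ideal.IsIntegral.comap_lt_comap (R := MvPolynomial (Fin s) k)
          (I := p.asIdeal) (J := q.asIdeal) hpq
    · refine iSup_le fun l => ?_
      obtain ⟨P, hP1, hP2⟩ :=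
        Ideal.nonempty_primesOver (S := A) (RelSeries.head l).asIdeal
      have := hP1
      have := hP2
      obtain ⟨L, hL, -⟩ := Ideal.exists_ltSeries_of_hasGoingUp l P
      rw [← hL]
      exact le_iSup (fun p : LTSeries (PrimeSpectrum A) => (p.length : WithBot ℕ∞)) L
  · have hb := (IsTranscendenceBasis.mvPolynomial (Fin s) k).algebraMap_comp (A := A)
    rw [← hb.cardinalMk_eq_trdeg]
    simp

theorem exists_isTranscendenceBasis_of_adjoin_eq_top {σ k A : Type} [Field k] [CommRing A]
    [IsDomain A] [Algebra k A] (x : σ → A) (hx : Algebra.adjoin k (Set.range x) = ⊤) :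
    ∃ u : Set A, u ⊆ Set.range x ∧ IsTranscendenceBasis k ((↑) : u → A) := by
  have : Algebra.IsAlgebraic (Algebra.adjoin k (Set.range x)) A := by
    refine ⟨fun a => ?_⟩
    have ha : a ∈ Algebra.adjoin k (Set.range x) := hx ▸ Algebra.mem_top
    exact isAlgebraic_algebraMap (⟨a, ha⟩ : Algebra.adjoin k (Set.range x))
  exact exists_isTranscendenceBasis_subset (R := k) (Set.range x)

/-- A domain generated by the images of finitely many variables contains as many algebraically
independent ones among them as its Krull dimension. -/
theorem exists_card_eq_of_le_ringKrullDim {σ k A : Type} [Finite σ] [Field k] [CommRing A]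
    [IsDomain A] [Algebra k A] (π : MvPolynomial σ k →ₐ[k] A) (hsurj : Function.Surjective π)
    (d : ℕ) (hd : (d : WithBot ℕ∞) ≤ ringKrullDim A) :
    ∃ T : Finset σ, T.card = d ∧
      ∀ g : MvPolynomial T k, π (rename Subtype.val g) = 0 → g = 0 := by
  classical
  have : Algebra.FiniteType k A := Algebra.FiniteType.of_surjective π hsurj
  obtain ⟨s, hs1, hs2⟩ := exists_ringKrullDim_eq_trdeg k A
  rw [hs1] at hd
  have hds : d ≤ s := by exact_mod_cast hd
  have hgen : Algebra.adjoin k (Set.range fun i => π (X i)) = ⊤ := by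
    rw [show (Set.range fun i => π (X i)) = π '' Set.range X by rw [← Set.range_comp]; rfl,
      ← AlgHom.map_adjoin, MvPolynomial.adjoin_range_X, Algebra.map_top]
    exact (AlgHom.range_eq_top π).mpr hsurj
  obtain ⟨u, hu, hbasis⟩ := exists_isTranscendenceBasis_of_adjoin_eq_top _ hgen
  choose v hv using fun y : u => hu y.2
  have hvinj : Function.Injective v := fun y y' hyy => Subtype.ext (by
    rw [← hv y, ← hv y', hyy])
  have hcard : Cardinal.mk u = s := by rw [hbasis.cardinalMk_eq_trdeg, hs2]
  have : Finite u := Cardinal.lt_aleph0_iff_finite.mp (hcard ▸ Cardinal.natCast_lt_aleph0)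
  have := Fintype.ofFinite u
  have hcard' : Fintype.card u = s := by
    rw [Cardinal.mk_fintype] at hcard; exact_mod_cast hcard
  have hle : d ≤ (Finset.univ.image v).card := by
    rw [Finset.card_image_of_injective _ hvinj, Finset.card_univ, hcard']; exact hds
  obtain ⟨T, hT, hTc⟩ := Finset.exists_subset_card_eq hle
  refine ⟨T, hTc, fun g hg => ?_⟩
  have hw : ∀ t : T, ∃ y : u, v y = t := fun t => by
    simpa using hT t.2
  choose w hw using hw
  have hwinj : Function.Injective w := fun t t' htt => Subtype.ext (by
    rw [← hw t, ← hw t', htt])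
  have hind : AlgebraicIndependent k fun t : T => ((w t : u) : A) :=
    hbasis.1.comp w hwinj
  apply hind
  have : aeval (fun t : T => ((w t : u) : A)) = π.comp (rename Subtype.val) := by
    ext t
    simp [← hv, hw]
  rw [map_zero, this, AlgHom.comp_apply, hg]

theorem card_le_ringKrullDim_of_injective {τ k A : Type} [Fintype τ] [Field k] [CommRing A]
    [IsDomain A] [Algebra k A] [Algebra.FiniteType k A] (f : MvPolynomial τ k →ₐ[k] A)
    (hf : Function.Injective f) : (Fintype.card τ : WithBot ℕ∞) ≤ ringKrullDim A := by
  obtain ⟨s, hs1, hs2⟩ := exists_ringKrullDim_eq_trdeg k A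
  have h := trdeg_le_of_injective f hf
  rw [hs2, MvPolynomial.trdeg_of_isDomain] at h
  simp only [Cardinal.mk_fintype, Cardinal.lift_natCast, Nat.cast_le] at h
  rw [hs1]
  exact_mod_cast h

/-- The Krull dimension of `k[σ] / I` is the largest size of a set of variables that are
algebraically independent modulo `I`. -/
theorem le_ringKrullDim_quotient_iff {σ k : Type} [Finite σ] [Field k]
    (I : Ideal (MvPolynomial σ k)) (d : ℕ) :
    (d : WithBot ℕ∞) ≤ ringKrullDim (MvPolynomial σ k ⧸ I) ↔
      ∃ T : Finset σ, T.card = d ∧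
        ∀ g : MvPolynomial T k, rename Subtype.val g ∈ I → g = 0 := by
  constructor
  · intro h
    obtain ⟨l, hl⟩ := Order.le_krullDim_iff.mp h
    set p := RelSeries.head l
    -- Dividing by the smallest prime of a chain of length `d` leaves a domain that still has
    -- dimension at least `d`.
    have hp : (d : WithBot ℕ∞) ≤ ringKrullDim ((MvPolynomial σ k ⧸ I) ⧸ p.asIdeal) := by
      rw [ringKrullDim_quotient]
      have h1 : (d : ℕ∞) ≤ Order.coheight p := by
        rw [← hl]; exact Order.length_le_coheight_head
      have h2 : (d : WithBot ℕ∞) ≤ (Order.coheight p : WithBot ℕ∞) := by exact_mod_cast h1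
      rw [Order.coheight_eq_krullDim_Ici] at h2
      exact h2
    obtain ⟨T, hTc, hT⟩ := exists_card_eq_of_le_ringKrullDim
      (A := (MvPolynomial σ k ⧸ I) ⧸ p.asIdeal) ((Ideal.Quotient.mkₐ k p.asIdeal).comp (Ideal.Quotient.mkₐ k I))
      ((Ideal.Quotient.mkₐ_surjective k _).comp (Ideal.Quotient.mkₐ_surjective k _)) d hp
    refine ⟨T, hTc, fun g hg => hT g ?_⟩
    simp only [AlgHom.comp_apply, Ideal.Quotient.mkₐ_eq_mk]
    rw [Ideal.Quotient.eq_zero_iff_mem.mpr hg, map_zero]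
  · rintro ⟨T, rfl, hT⟩
    set f : MvPolynomial T k →ₐ[k] (MvPolynomial σ k ⧸ I) :=
      (Ideal.Quotient.mkₐ k I).comp (rename Subtype.val) with hf
    have hfinj : Function.Injective f := by
      rw [injective_iff_map_eq_zero]
      intro g hg
      exact hT g (Ideal.Quotient.eq_zero_iff_mem.mp hg)
    -- A prime that avoids all nonzero polynomials in the variables of `T` keeps these variables
    -- independent in the quotient domain.
    have hdisj : Disjoint ((⊥ : Ideal (MvPolynomial σ k ⧸ I)) : Set (MvPolynomial σ k ⧸ I))
        (Submonoid.map f (nonZeroDivisors (MvPolynomial T k)) : Set _) := by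
      rw [Set.disjoint_left]
      rintro x hx ⟨g, hg, rfl⟩
      have : g = 0 := hfinj (by rw [map_zero]; exact hx)
      exact nonZeroDivisors.ne_zero hg this
    obtain ⟨P, hP, -, hPd⟩ := Ideal.exists_le_prime_disjoint _ _ hdisj
    refine le_trans ?_ (ringKrullDim_quotient_le P)
    have hinj : Function.Injective ((Ideal.Quotient.mkₐ k P).comp f) := by
      rw [injective_iff_map_eq_zero]
      intro g hg
      by_contra hg0
      exact Set.disjoint_left.mp hPd (Ideal.Quotient.eq_zero_iff_mem.mp hg)
        ⟨g, mem_nonZeroDivisors_of_ne_zero hg0, rfl⟩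
    rw [← Fintype.card_coe T]
    exact card_le_ringKrullDim_of_injective (A := (MvPolynomial σ k ⧸ I) ⧸ P) _ hinj

/-! ### Complex points and Chevalley's theorem -/

theorem eval_comp_eq {τ : Type} {S : Type} [CommRing S] [Algebra ℂ S] (π : MvPolynomial τ ℂ →ₐ[ℂ] S)
    (ψ : S →ₐ[ℂ] ℂ) (q : MvPolynomial τ ℂ) : eval (fun i => ψ (π (X i))) q = ψ (π q) := by
  have : aeval (fun i => ψ (π (X i))) = ψ.comp π := by ext i; simp
  rw [← AlgHom.comp_apply, ← this]
  rfl

/-- This is the Nullstellensatz: the quotient by a maximal ideal above `Q` is a finite extension of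
`ℂ`, hence maps to `ℂ`. -/
theorem exists_algHom_of_ne_top {B : Type} [CommRing B] [Algebra ℂ B] [Algebra.FiniteType ℂ B]
    (Q : Ideal B) (hQ : Q ≠ ⊤) : ∃ ψ : B →ₐ[ℂ] ℂ, ∀ b ∈ Q, ψ b = 0 := by
  obtain ⟨M, hM, hQM⟩ := Ideal.exists_le_maximal Q hQ
  let : Field (B ⧸ M) := Ideal.Quotient.field M
  have : Algebra.FiniteType ℂ (B ⧸ M) :=
    Algebra.FiniteType.of_surjective (Ideal.Quotient.mkₐ ℂ M) (Ideal.Quotient.mkₐ_surjective ℂ M)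
  have : Module.Finite ℂ (B ⧸ M) := finite_of_finite_type_of_isJacobsonRing ℂ (B ⧸ M)
  have : Algebra.IsAlgebraic ℂ (B ⧸ M) := Algebra.IsAlgebraic.of_finite ℂ _
  let φ : (B ⧸ M) →ₐ[ℂ] ℂ := IsAlgClosed.lift
  refine ⟨φ.comp (Ideal.Quotient.mkₐ ℂ M), fun b hb => ?_⟩
  simp [Ideal.Quotient.eq_zero_iff_mem.mpr (hQM hb)]

/-- A dominant morphism from an affine variety to affine space over `ℂ` covers the complement of a
hypersurface. -/
theorem exists_forall_exists_algHom {ρ B : Type} [Finite ρ] [CommRing B] [Algebra ℂ B]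
    [Algebra.FiniteType ℂ B] (f : MvPolynomial ρ ℂ →ₐ[ℂ] B) (hf : Function.Injective f) :
    ∃ h : MvPolynomial ρ ℂ, h ≠ 0 ∧ ∀ u : ρ → ℂ, eval u h ≠ 0 →
      ∃ ψ : B →ₐ[ℂ] ℂ, ∀ i, ψ (f (X i)) = u i := by
  have hft : f.toRingHom.FiniteType := by
    refine RingHom.FiniteType.of_comp_finiteType (f := algebraMap ℂ (MvPolynomial ρ ℂ)) ?_
    have : (f.toRingHom.comp (algebraMap ℂ (MvPolynomial ρ ℂ))) = algebraMap ℂ B :=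
      f.comp_algebraMap
    rw [this]
    exact RingHom.finiteType_algebraMap.mpr inferInstance
  have hfp : f.toRingHom.FinitePresentation := RingHom.FinitePresentation.of_finiteType.mp hft
  obtain ⟨S, hS⟩ := PrimeSpectrum.exists_constructibleSetData_iff.mpr
    (PrimeSpectrum.isConstructible_range_comap hfp)
  -- The image on spectra is constructible and contains the generic point. The piece containing that
  -- point has no nontrivial equations, so it is the complement of the hypersurface `C.f = 0`.
  have hbot : (⊥ : PrimeSpectrum (MvPolynomial ρ ℂ)) ∈ S.toSet := by
    rw [hS]
    obtain ⟨Q, hQ, hQ'⟩ := Ideal.exists_comap_eq_of_mem_minimalPrimes_of_injective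
      (f := f.toRingHom) hf (⊥ : Ideal (MvPolynomial ρ ℂ))
      (by rw [IsDomain.minimalPrimes_eq_singleton_bot]; rfl)
    exact ⟨⟨Q, hQ⟩, PrimeSpectrum.ext hQ'⟩
  simp only [PrimeSpectrum.ConstructibleSetData.toSet, Set.mem_iUnion] at hbot
  obtain ⟨C, hC, hCb⟩ := hbot
  have hg : ∀ i, C.g i = 0 := fun i => hCb.1 ⟨i, rfl⟩
  have hf0 : C.f ≠ 0 := fun h0 => hCb.2 (by
    rintro x (rfl : x = C.f)
    exact h0)
  refine ⟨C.f, hf0, fun u hu => ?_⟩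
  have hmem : (pointToPoint u : PrimeSpectrum (MvPolynomial ρ ℂ)) ∈ S.toSet := by
    simp only [PrimeSpectrum.ConstructibleSetData.toSet, Set.mem_iUnion]
    refine ⟨C, hC, ?_, fun h => hu ?_⟩
    · rintro _ ⟨i, rfl⟩
      rw [hg i]
      exact Submodule.zero_mem _
    · exact (mem_vanishingIdeal_singleton_iff u C.f).mp (h rfl)
  rw [hS] at hmem
  obtain ⟨Q, hQ⟩ := hmem
  obtain ⟨ψ, hψ⟩ := exists_algHom_of_ne_top Q.asIdeal Q.isPrime.ne_top
  refine ⟨ψ, fun i => ?_⟩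
  have h1 : (X i - MvPolynomial.C (u i) : MvPolynomial ρ ℂ) ∈
      (pointToPoint u : PrimeSpectrum (MvPolynomial ρ ℂ)).asIdeal :=
    (mem_vanishingIdeal_singleton_iff u _).mpr (by simp)
  rw [← hQ] at h1
  have h2 := hψ _ h1
  have h3 : f (MvPolynomial.C (u i)) = algebraMap ℂ B (u i) := f.commutes (u i)
  simp only [AlgHom.toRingHom_eq_coe, RingHom.coe_coe, map_sub, h3, AlgHom.commutes] at h2
  exact sub_eq_zero.mp h2

/-- **Chevalley's dichotomy** for a principal open part of an algebraic set. -/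
theorem coordProj_dichotomy_basic {τ ρ : Type} [Finite τ] [Finite ρ] (I : Ideal (MvPolynomial τ ℂ))
    (g : MvPolynomial τ ℂ) (φ : ρ → τ) :
    (∃ h : MvPolynomial ρ ℂ, h ≠ 0 ∧
      ∀ v ∈ zeroLocus ℂ I, eval v g ≠ 0 → eval (v ∘ φ) h = 0) ∨
    ∃ h : MvPolynomial ρ ℂ, h ≠ 0 ∧
      ∀ u, eval u h ≠ 0 → ∃ v ∈ zeroLocus ℂ I, eval v g ≠ 0 ∧ v ∘ φ = u := by
  let A := MvPolynomial τ ℂ ⧸ I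
  let π : MvPolynomial τ ℂ →ₐ[ℂ] A := Ideal.Quotient.mkₐ ℂ I
  let B := Localization.Away (π g)
  let ι : MvPolynomial τ ℂ →ₐ[ℂ] B := (IsScalarTower.toAlgHom ℂ A B).comp π
  have : Algebra.FiniteType ℂ A :=
    Algebra.FiniteType.of_surjective π (Ideal.Quotient.mkₐ_surjective ℂ I)
  have : Algebra.FinitePresentation A B := IsLocalization.Away.finitePresentation (π g)
  have : Algebra.FiniteType ℂ B := Algebra.FiniteType.trans (S := A) inferInstance inferInstance
  have hunit : IsUnit (ι g) := IsLocalization.Away.algebraMap_isUnit (π g)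
  have hI : ∀ q ∈ I, ι q = 0 := fun q hq => by
    have : π q = 0 := Ideal.Quotient.eq_zero_iff_mem.mpr hq
    simp only [ι, AlgHom.comp_apply, this, map_zero]
  -- `B` is the coordinate ring of the part of the algebraic set where `g` does not vanish. The
  -- projection is dominant exactly when the map to `B` is injective; a nonzero kernel element is
  -- the hypersurface sought.
  by_cases hinj : Function.Injective (ι.comp (rename φ))
  · right
    obtain ⟨h, h0, hh⟩ := exists_forall_exists_algHom _ hinj
    refine ⟨h, h0, fun u hu => ?_⟩
    obtain ⟨ψ, hψ⟩ := hh u hu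
    refine ⟨fun i => ψ (ι (X i)), fun q hq => ?_, ?_, ?_⟩
    · change eval _ q = 0
      rw [eval_comp_eq, hI q hq, map_zero]
    · rw [eval_comp_eq]
      exact (hunit.map ψ).ne_zero
    · ext i
      simpa using hψ i
  · left
    rw [injective_iff_map_eq_zero] at hinj
    push Not at hinj
    obtain ⟨h, hh, h0⟩ := hinj
    refine ⟨h, h0, fun v hv hgv => ?_⟩
    let e : A →+* ℂ := Ideal.Quotient.lift I (eval v) hv
    have he : IsUnit (e (π g)) := isUnit_iff_ne_zero.mpr hgv
    have h1 : IsLocalization.Away.lift (S := B) (π g) he (algebraMap A B (π (rename φ h))) = 0 := by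
      have : algebraMap A B (π (rename φ h)) = 0 := hh
      rw [this, map_zero]
    rw [IsLocalization.Away.lift_eq] at h1
    have h2 : eval v (rename φ h) = 0 := h1
    rwa [eval_rename] at h2

/-- **Chevalley's dichotomy**: a coordinate projection of a difference of two algebraic sets is
contained in a hypersurface or contains the complement of one. -/
theorem coordProj_dichotomy {τ ρ : Type} [Finite τ] [Finite ρ] {V W : Set (τ → ℂ)}
    (hV : IsAlgebraicSet V) (hW : IsAlgebraicSet W) (φ : ρ → τ) :
    (∃ h : MvPolynomial ρ ℂ, h ≠ 0 ∧ ∀ v ∈ V \ W, eval (v ∘ φ) h = 0) ∨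
    ∃ h : MvPolynomial ρ ℂ, h ≠ 0 ∧ ∀ u, eval u h ≠ 0 → ∃ v ∈ V \ W, v ∘ φ = u := by
  classical
  obtain ⟨I, rfl⟩ := hV
  obtain ⟨J, rfl⟩ := hW
  obtain ⟨G, rfl⟩ := (isNoetherianRing_iff_ideal_fg _).mp inferInstance J
  -- `V \ W` is the finite union of the loci `g ≠ 0` in `V`, for `g` among the generators of the
  -- ideal of `W`.
  by_cases hex : ∃ g ∈ G, ∃ h : MvPolynomial ρ ℂ, h ≠ 0 ∧
      ∀ u, eval u h ≠ 0 → ∃ v ∈ zeroLocus ℂ I, eval v g ≠ 0 ∧ v ∘ φ = u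
  · obtain ⟨g, hg, h, h0, hh⟩ := hex
    refine .inr ⟨h, h0, fun u hu => ?_⟩
    obtain ⟨v, hv, hgv, hvu⟩ := hh u hu
    exact ⟨v, ⟨hv, fun hvJ => hgv (hvJ g (Ideal.subset_span hg))⟩, hvu⟩
  · have hall : ∀ g : G, ∃ h : MvPolynomial ρ ℂ, h ≠ 0 ∧
        ∀ v ∈ zeroLocus ℂ I, eval v g.1 ≠ 0 → eval (v ∘ φ) h = 0 := fun g =>
      (coordProj_dichotomy_basic I g.1 φ).resolve_right fun hg => hex ⟨g.1, g.2, hg⟩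
    choose h h0 hh using hall
    refine .inl ⟨∏ g, h g, Finset.prod_ne_zero_iff.mpr fun g _ => h0 g, fun v hv => ?_⟩
    obtain ⟨g, hg, hgv⟩ : ∃ g ∈ G, eval v g ≠ 0 := by
      by_contra hcon
      push Not at hcon
      refine hv.2 ?_
      rw [zeroLocus_span]
      exact fun g hg => hcon g hg
    rw [map_prod]
    exact Finset.prod_eq_zero (Finset.mem_univ ⟨g, hg⟩) (hh ⟨g, hg⟩ v hv.1 hgv)

/-! ### Dimension through dominant coordinate projections -/

/-- The projection of `S` to the coordinates in `T` is Zariski dense. -/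
def Dominates {σ : Type} (S : Set (σ → ℂ)) (T : Finset σ) : Prop :=
  ∀ g : MvPolynomial T ℂ, g ≠ 0 → ∃ s ∈ S, eval (fun t : T => s t) g ≠ 0

theorem exists_eval_ne_zero {σ : Type} {h : MvPolynomial σ ℂ} (h0 : h ≠ 0) :
    ∃ v, eval v h ≠ 0 := by
  by_contra hcon
  push Not at hcon
  exact h0 (MvPolynomial.funext fun v => by rw [hcon v, map_zero])

theorem ne_zero_of_eval_ne_zero {σ : Type} {h : MvPolynomial σ ℂ} {v : σ → ℂ}
    (hv : eval v h ≠ 0) : h ≠ 0 := by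
  rintro rfl
  exact hv (map_zero _)

theorem eval_aeval {σ τ : Type} (F : σ → MvPolynomial τ ℂ) (h : MvPolynomial σ ℂ) (v : τ → ℂ) :
    eval v (aeval F h) = eval (fun i => eval v (F i)) h := by
  have : (aeval v).comp (aeval F) = (aeval fun i => eval v (F i) : MvPolynomial σ ℂ →ₐ[ℂ] ℂ) := by
    ext i
    simp [aeval_eq_eval]
  exact DFunLike.congr_fun this h

theorem generically_of_eval_ne_zero {σ : Type} {P : (σ → ℂ) → Prop} {h : MvPolynomial σ ℂ}
    (h0 : h ≠ 0) (hP : ∀ c, eval c h ≠ 0 → P c) : Generically P := by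
  refine ⟨zeroLocus ℂ (Ideal.span {h}), ⟨_, rfl⟩, fun huniv => ?_, fun c hc => hP c fun hc0 => ?_⟩
  · obtain ⟨v, hv⟩ := exists_eval_ne_zero h0
    have hmem : v ∈ zeroLocus ℂ (Ideal.span {h}) := huniv ▸ Set.mem_univ v
    exact hv (hmem h (Ideal.subset_span rfl))
  · refine hc ?_
    rw [zeroLocus_span]
    rintro q rfl
    exact hc0

theorem vanishingIdeal_zariskiClosure {σ : Type} (S : Set (σ → ℂ)) :
    vanishingIdeal ℂ (zariskiClosure S) = vanishingIdeal ℂ S :=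
  le_antisymm (vanishingIdeal_anti_mono (zeroLocus_vanishingIdeal_le S))
    (le_vanishingIdeal_zeroLocus _)

/-- Variables are independent modulo the vanishing ideal exactly when no nonzero polynomial in them
vanishes on `S`. -/
theorem le_algDim_iff {σ : Type} [Finite σ] (S : Set (σ → ℂ)) (d : ℕ) :
    (d : WithBot ℕ∞) ≤ algDim (zariskiClosure S) ↔ ∃ T : Finset σ, T.card = d ∧ Dominates S T := by
  rw [algDim, vanishingIdeal_zariskiClosure, le_ringKrullDim_quotient_iff]
  refine exists_congr fun T => and_congr_right fun _ => forall_congr' fun g => ?_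
  rw [← not_imp_not]
  refine imp_congr_right fun _ => ?_
  rw [mem_vanishingIdeal_iff]
  push Not
  refine exists_congr fun s => and_congr_right fun _ => ?_
  change eval s (rename Subtype.val g) ≠ 0 ↔ _
  rw [eval_rename]
  rfl

theorem withBot_enat_le_of_forall_natCast {x y : WithBot ℕ∞}
    (h : ∀ k : ℕ, (k : WithBot ℕ∞) ≤ x → (k : WithBot ℕ∞) ≤ y) : x ≤ y := by
  induction x with
  | bot => exact bot_le
  | coe x =>
    induction x with
    | coe k => exact h k le_rfl
    | top =>
      induction y with
      | bot => exact absurd (h 0 le_top) (by simp)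
      | coe y =>
        have : ∀ k : ℕ, (k : ℕ∞) ≤ y := fun k => by exact_mod_cast h k le_top
        rw [ENat.eq_top_iff_forall_ge.mpr this]

/-- If `S` does not dominate any set of variables that is larger than `T`, then its projection to
the coordinates in `T` has finite fibers over generic points. -/
theorem exists_finite_fiber {σ : Type} [Finite σ] {S : Set (σ → ℂ)} {T : Finset σ}
    (hS : ∀ T' : Finset σ, T'.card = T.card + 1 → ¬ Dominates S T') :
    ∃ q : MvPolynomial T ℂ, q ≠ 0 ∧ ∀ t : T → ℂ, eval t q ≠ 0 →
      {p | p ∈ S ∧ (fun i : T => p i) = t}.Finite := by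
  classical
  have := Fintype.ofFinite σ
  have hcoord : ∀ s : σ, ∃ q : MvPolynomial T ℂ, q ≠ 0 ∧ ∀ t : T → ℂ, eval t q ≠ 0 →
      ∃ R : Set ℂ, R.Finite ∧ ∀ p ∈ S, (fun i : T => p i) = t → p s ∈ R := by
    intro s
    by_cases hs : s ∈ T
    · exact ⟨1, one_ne_zero, fun t _ => ⟨{t ⟨s, hs⟩}, Set.finite_singleton _,
        fun p _ hp => congrFun hp ⟨s, hs⟩⟩⟩
    · have hT := hS (insert s T) (Finset.card_insert_of_notMem hs)
      unfold Dominates at hT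
      push Not at hT
      obtain ⟨G, hG0, hG⟩ := hT
      obtain ⟨w, hw⟩ := exists_eval_ne_zero hG0
      -- `G` is a relation between the coordinate `s` and those in `T`. Freezing `s` at `w s` gives
      -- a polynomial in `T`; where it is nonzero, `G` stays a nonzero polynomial in the coordinate
      -- `s` (`K` below), and its roots bound that coordinate.
      let F : {i // i ∈ insert s T} → MvPolynomial T ℂ := fun i =>
        if hi : i.1 ∈ T then X ⟨i.1, hi⟩ else C (w i)
      have hF : ∀ t : T → ℂ, (fun i => eval t (F i)) =
          fun i => if hi : i.1 ∈ T then t ⟨i.1, hi⟩ else w i := fun t => by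
        funext i
        by_cases hi : i.1 ∈ T <;> simp [F, hi]
      refine ⟨aeval F G, ?_, fun t ht => ?_⟩
      · refine ne_zero_of_eval_ne_zero (v := fun i => w ⟨i.1, Finset.mem_insert_of_mem i.2⟩) ?_
        rw [eval_aeval, hF]
        convert hw using 3
        funext i
        split_ifs <;> rfl
      · let K : {i // i ∈ insert s T} → Polynomial ℂ := fun i =>
          if hi : i.1 ∈ T then Polynomial.C (t ⟨i.1, hi⟩) else Polynomial.X
        have hK : ∀ y : ℂ, Polynomial.eval y (aeval K G) =
            eval (fun i => if hi : i.1 ∈ T then t ⟨i.1, hi⟩ else y) G := by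
          intro y
          have : (Polynomial.aeval y).comp (aeval K) =
              (aeval fun i : {i // i ∈ insert s T} => if hi : i.1 ∈ T then t ⟨i.1, hi⟩ else y :
                MvPolynomial {i // i ∈ insert s T} ℂ →ₐ[ℂ] ℂ) := by
            ext i
            by_cases hi : i.1 ∈ T <;> simp [K, hi]
          exact DFunLike.congr_fun this G
        have hval : ∀ i : {i // i ∈ insert s T}, i.1 ∉ T →
            i = ⟨s, Finset.mem_insert_self s T⟩ := fun i hi =>
          Subtype.ext ((Finset.mem_insert.mp i.2).resolve_right hi)
        have hK0 : aeval K G ≠ 0 := by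
          intro h0
          rw [eval_aeval, hF] at ht
          have := hK (w ⟨s, Finset.mem_insert_self s T⟩)
          rw [h0, Polynomial.eval_zero] at this
          refine ht (Eq.trans ?_ this.symm)
          congr 2
          funext i
          by_cases hi : i.1 ∈ T
          · simp [hi]
          · simp [hval i hi, hs]
        refine ⟨{y | (aeval K G).IsRoot y}, Polynomial.finite_setOfPred_isRoot hK0, fun p hp hpt => ?_⟩
        change Polynomial.eval (p s) (aeval K G) = 0
        rw [hK, ← hG p hp]
        congr 2
        funext i
        by_cases hi : i.1 ∈ T
        · simp [hi, ← hpt]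
        · simp [hval i hi, hs]
  choose q hq0 hq using hcoord
  refine ⟨∏ s, q s, Finset.prod_ne_zero_iff.mpr fun s _ => hq0 s, fun t ht => ?_⟩
  rw [map_prod, Finset.prod_ne_zero_iff] at ht
  choose R hR hRS using fun s => hq s t (ht s (Finset.mem_univ s))
  refine (Set.Finite.pi' hR).subset fun p hp s => hRS s p hp.1 hp.2

/-! ### Generic dimension in a family -/

/-- Substitute values for the second group of variables. -/
def evalRight {κ ω : Type} (h : MvPolynomial (κ ⊕ ω) ℂ) (u : ω → ℂ) : MvPolynomial κ ℂ :=
  aeval (Sum.elim X fun i => C (u i)) h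

/-- Substitute values for the first group of variables. -/
def evalLeft {κ ω : Type} (h : MvPolynomial (κ ⊕ ω) ℂ) (c : κ → ℂ) : MvPolynomial ω ℂ :=
  aeval (Sum.elim (fun i => C (c i)) X) h

@[simp]
theorem eval_evalRight {κ ω : Type} (h : MvPolynomial (κ ⊕ ω) ℂ) (u : ω → ℂ) (c : κ → ℂ) :
    eval c (evalRight h u) = eval (Sum.elim c u) h := by
  rw [evalRight, eval_aeval]
  congr 2
  funext i
  cases i <;> simp

@[simp]
theorem eval_evalLeft {κ ω : Type} (h : MvPolynomial (κ ⊕ ω) ℂ) (c : κ → ℂ) (u : ω → ℂ) :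
    eval u (evalLeft h c) = eval (Sum.elim c u) h := by
  rw [evalLeft, eval_aeval]
  congr 2
  funext i
  cases i <;> simp

theorem exists_eval_sumElim_ne_zero {κ ω : Type} {h : MvPolynomial (κ ⊕ ω) ℂ} (h0 : h ≠ 0) :
    ∃ c u, eval (Sum.elim c u) h ≠ 0 := by
  obtain ⟨v, hv⟩ := exists_eval_ne_zero h0
  exact ⟨v ∘ Sum.inl, v ∘ Sum.inr, by rwa [Sum.elim_comp_inl_inr]⟩

/-- The points of the family `J` project, over generic constants, onto a set containing the
complement of a hypersurface in the coordinates `T`. -/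
def GenericallyCovers {κ μ : Type} (J : (κ → ℂ) → Set (μ → ℂ)) (T : Finset μ) : Prop :=
  ∃ h : MvPolynomial (κ ⊕ T) ℂ, h ≠ 0 ∧
    ∀ c t, eval (Sum.elim c t) h ≠ 0 → ∃ p ∈ J c, (fun i : T => p i) = t

/-- The points of the family `J` project into a hypersurface in the coordinates `T` and the
constants. -/
def GenericallyMisses {κ μ : Type} (J : (κ → ℂ) → Set (μ → ℂ)) (T : Finset μ) : Prop :=
  ∃ h : MvPolynomial (κ ⊕ T) ℂ, h ≠ 0 ∧
    ∀ c, ∀ p ∈ J c, eval (Sum.elim c fun i : T => p i) h = 0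

/-- For fixed generic `c` the hypersurface in constants and coordinates restricts to a proper
hypersurface in the coordinates. There are finitely many `T`, so the exceptional constants can be
collected in one hypersurface. -/
theorem exists_dominates_iff_genericallyCovers {κ μ : Type} [Finite μ]
    {J : (κ → ℂ) → Set (μ → ℂ)}
    (hJ : ∀ T, GenericallyMisses J T ∨ GenericallyCovers J T) :
    ∃ h : MvPolynomial κ ℂ, h ≠ 0 ∧
      ∀ c, eval c h ≠ 0 → ∀ T, Dominates (J c) T ↔ GenericallyCovers J T := by
  classical
  have := Fintype.ofFinite μ
  have hT : ∀ T : Finset μ, ∃ h : MvPolynomial κ ℂ, h ≠ 0 ∧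
      ∀ c, eval c h ≠ 0 → (Dominates (J c) T ↔ GenericallyCovers J T) := by
    intro T
    by_cases hc : GenericallyCovers J T
    · obtain ⟨h, h0, hh⟩ := id hc
      obtain ⟨c₀, u₀, hcu⟩ := exists_eval_sumElim_ne_zero h0
      refine ⟨evalRight h u₀, ne_zero_of_eval_ne_zero (v := c₀) (by simpa using hcu),
        fun c hcv => iff_of_true (fun g hg => ?_) hc⟩
      have hL : evalLeft h c ≠ 0 :=
        ne_zero_of_eval_ne_zero (v := u₀) (by simpa using hcv)
      obtain ⟨t, ht⟩ := exists_eval_ne_zero (mul_ne_zero hL hg)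
      rw [map_mul] at ht
      obtain ⟨p, hp, hpt⟩ := hh c t (by simpa using left_ne_zero_of_mul ht)
      exact ⟨p, hp, by rw [hpt]; exact right_ne_zero_of_mul ht⟩
    · obtain ⟨h, h0, hh⟩ := (hJ T).resolve_right hc
      obtain ⟨c₀, u₀, hcu⟩ := exists_eval_sumElim_ne_zero h0
      refine ⟨evalRight h u₀, ne_zero_of_eval_ne_zero (v := c₀) (by simpa using hcu),
        fun c hcv => iff_of_false (fun hdom => ?_) hc⟩
      have hL : evalLeft h c ≠ 0 :=
        ne_zero_of_eval_ne_zero (v := u₀) (by simpa using hcv)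
      obtain ⟨p, hp, hpe⟩ := hdom _ hL
      exact hpe (by rw [eval_evalLeft]; exact hh c p hp)
  choose h h0 hh using hT
  refine ⟨∏ T, h T, Finset.prod_ne_zero_iff.mpr fun T _ => h0 T, fun c hc T => hh T c ?_⟩
  rw [map_prod, Finset.prod_ne_zero_iff] at hc
  exact hc T (Finset.mem_univ T)

theorem exists_generic_algDim {κ μ : Type} [Finite μ] {J : (κ → ℂ) → Set (μ → ℂ)}
    (hJ : ∀ T, GenericallyMisses J T ∨ GenericallyCovers J T) :
    ∃ d : WithBot ℕ∞, Generically (fun c => algDim (zariskiClosure (J c)) = d) ∧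
      ∀ k : ℕ, (k : WithBot ℕ∞) ≤ d ↔ ∃ T : Finset μ, T.card = k ∧ GenericallyCovers J T := by
  obtain ⟨h, h0, hh⟩ := exists_dominates_iff_genericallyCovers hJ
  have hk : ∀ c, eval c h ≠ 0 → ∀ k : ℕ, (k : WithBot ℕ∞) ≤ algDim (zariskiClosure (J c)) ↔
      ∃ T : Finset μ, T.card = k ∧ GenericallyCovers J T := fun c hc k => by
    rw [le_algDim_iff]
    exact exists_congr fun T => and_congr_right fun _ => hh c hc T
  obtain ⟨c₀, hc₀⟩ := exists_eval_ne_zero h0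
  refine ⟨algDim (zariskiClosure (J c₀)), generically_of_eval_ne_zero h0 fun c hc => ?_,
    hk c₀ hc₀⟩
  exact le_antisymm
    (withBot_enat_le_of_forall_natCast fun k hle => (hk c₀ hc₀ k).mpr ((hk c hc k).mp hle))
    (withBot_enat_le_of_forall_natCast fun k hle => (hk c hc k).mpr ((hk c₀ hc₀ k).mp hle))

/-! ### Persistent parameters and stabilization -/

section Family

variable {κ μ : Type} (J : ∀ a : ℕ, (Fin a × κ → ℂ) → Set (μ → ℂ))

/-- The parameters that occur in `J 1` over a Zariski dense set of constants. -/
def persistent : Set (μ → ℂ) :=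
  {p | ∀ q : MvPolynomial κ ℂ, q ≠ 0 → ∃ c, eval c q ≠ 0 ∧ p ∈ J 1 fun s => c s.2}

variable {J}

/-- A hypersurface containing the smaller system's points also contains those of the larger one,
which cannot cover the complement of another hypersurface. -/
theorem genericallyCovers_of_succ {a : ℕ} {T : Finset μ}
    (hdich : GenericallyMisses (J a) T ∨ GenericallyCovers (J a) T)
    (hinit : ∀ c, J (a + 1) c ⊆ J a fun s => c (s.1.castSucc, s.2))
    (hT : GenericallyCovers (J (a + 1)) T) : GenericallyCovers (J a) T := by
  refine hdich.resolve_left ?_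
  rintro ⟨g, g0, hg⟩
  obtain ⟨h, h0, hh⟩ := hT
  let e : (Fin a × κ) ⊕ T → (Fin (a + 1) × κ) ⊕ T :=
    Sum.map (fun s => (s.1.castSucc, s.2)) id
  have he : Function.Injective e := Function.Injective.sumMap
    (fun s s' hs => by
      rw [Prod.mk.injEq, Fin.castSucc_inj] at hs
      exact Prod.ext hs.1 hs.2) Function.injective_id
  have hg0 : rename e g ≠ 0 := (map_ne_zero_iff _ (rename_injective e he)).mpr g0
  obtain ⟨c, t, hct⟩ := exists_eval_sumElim_ne_zero (mul_ne_zero h0 hg0)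
  rw [map_mul] at hct
  obtain ⟨p, hp, rfl⟩ := hh c t (left_ne_zero_of_mul hct)
  refine right_ne_zero_of_mul hct ?_
  rw [eval_rename, ← hg _ p (hinit c hp)]
  congr 2
  funext i
  cases i <;> rfl

/-- If `h` vanished on the whole family, then a persistent `p` with `h(c₀, p) ≠ 0` would contradict
the density of the constants over which `p` occurs. -/
theorem genericallyCovers_of_dominates_persistent {j : ℕ} {T : Finset μ}
    (hdich : GenericallyMisses (J j) T ∨ GenericallyCovers (J j) T)
    (hdense : ∀ p ∈ persistent J, ∀ q : MvPolynomial (Fin j × κ) ℂ, q ≠ 0 →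
      ∃ c, eval c q ≠ 0 ∧ p ∈ J j c)
    (hT : Dominates (persistent J) T) : GenericallyCovers (J j) T := by
  refine hdich.resolve_left ?_
  rintro ⟨h, h0, hh⟩
  obtain ⟨c₀, t₀, hct⟩ := exists_eval_sumElim_ne_zero h0
  obtain ⟨p, hp, hpe⟩ := hT (evalLeft h c₀)
    (ne_zero_of_eval_ne_zero (v := t₀) (by simpa using hct))
  obtain ⟨c, hc, hpc⟩ := hdense p hp (evalRight h fun i : T => p i)
    (ne_zero_of_eval_ne_zero (v := c₀) (by simpa using hpe))
  exact hc (by rw [eval_evalRight]; exact hh c p hpc)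

/-- If the dimension does not drop when a component system is added, then the persistent parameters
make up a set of that dimension. -/
theorem dominates_persistent [Finite μ] {a : ℕ} {T : Finset μ}
    (hdich : ∀ T, GenericallyMisses (J a) T ∨ GenericallyCovers (J a) T)
    (hinit : ∀ c, J (a + 1) c ⊆ J a fun s => c (s.1.castSucc, s.2))
    (hlast : ∀ c, J (a + 1) c ⊆ J 1 fun s => c (Fin.last a, s.2))
    (hmax : ∀ T' : Finset μ, T'.card = T.card + 1 → ¬ GenericallyCovers (J a) T')
    (hT : GenericallyCovers (J (a + 1)) T) : Dominates (persistent J) T := by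
  intro g g0
  by_contra hcon
  push Not at hcon
  obtain ⟨h, h0, hh⟩ := hT
  obtain ⟨k, k0, hk⟩ := exists_dominates_iff_genericallyCovers hdich
  let e : Fin a × κ → (Fin (a + 1) × κ) ⊕ T := fun s => Sum.inl (s.1.castSucc, s.2)
  have he : Function.Injective e := fun s s' hs => by
    have := Sum.inl.inj hs
    rw [Prod.mk.injEq, Fin.castSucc_inj] at this
    exact Prod.ext this.1 this.2
  obtain ⟨c₀, t₀, hct⟩ := exists_eval_sumElim_ne_zero
    (mul_ne_zero h0 ((map_ne_zero_iff _ (rename_injective e he)).mpr k0))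
  rw [map_mul, eval_rename] at hct
  set c : Fin a × κ → ℂ := fun s => c₀ (s.1.castSucc, s.2) with hc
  have hkc : eval c k ≠ 0 := right_ne_zero_of_mul hct
  obtain ⟨q, q0, hq⟩ := exists_finite_fiber (S := J a c) (T := T)
    fun T' hT' hdom => hmax T' hT' ((hk c hkc T').mp hdom)
  have hL : evalLeft h c₀ ≠ 0 :=
    ne_zero_of_eval_ne_zero (v := t₀) (by simpa using left_ne_zero_of_mul hct)
  obtain ⟨t, ht⟩ := exists_eval_ne_zero (mul_ne_zero (mul_ne_zero hL q0) g0)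
  rw [map_mul, map_mul] at ht
  have hfin := hq t (right_ne_zero_of_mul (left_ne_zero_of_mul ht))
  have hht : eval (Sum.elim c₀ t) h ≠ 0 := by
    simpa using left_ne_zero_of_mul (left_ne_zero_of_mul ht)
  -- Since `g` is nonzero at `t`, no point of this finite fiber is persistent: the constants over
  -- which it occurs lie in a hypersurface `N p`.
  have hnot : ∀ p : {p | p ∈ J a c ∧ (fun i : T => p i) = t}, ∃ q : MvPolynomial κ ℂ, q ≠ 0 ∧
      ∀ c', p.1 ∈ J 1 (fun s => c' s.2) → eval c' q = 0 := by
    rintro ⟨p, hp, hpt⟩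
    by_contra hall
    push Not at hall
    refine right_ne_zero_of_mul ht ?_
    rw [← hpt]
    refine hcon p fun q hq => ?_
    obtain ⟨c', hc', hne⟩ := hall q hq
    exact ⟨c', hne, hc'⟩
  choose N N0 hN using hnot
  have := hfin.fintype
  -- Only the last block of constants stays free. It is chosen outside all `N p` and such that `t`
  -- is still covered.
  let F : (Fin (a + 1) × κ) ⊕ T → MvPolynomial κ ℂ := Sum.elim
    (fun s => Fin.lastCases (motive := fun _ => MvPolynomial κ ℂ) (X s.2)
      (fun i => C (c (i, s.2))) s.1) (fun i => C (t i))
  let join : (κ → ℂ) → Fin (a + 1) × κ → ℂ := fun c' s =>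
    Fin.lastCases (motive := fun _ => ℂ) (c' s.2) (fun i => c (i, s.2)) s.1
  have hF : ∀ c', eval c' (aeval F h) = eval (Sum.elim (join c') t) h := by
    intro c'
    rw [eval_aeval]
    congr 2
    funext i
    rcases i with ⟨i, s⟩ | i
    · induction i using Fin.lastCases <;> simp [F, join]
    · simp [F]
  have hF0 : aeval F h ≠ 0 := by
    refine ne_zero_of_eval_ne_zero (v := fun s => c₀ (Fin.last a, s)) ?_
    rw [hF]
    convert hht using 4
    funext ⟨i, s⟩
    induction i using Fin.lastCases <;> simp [join, hc]
  obtain ⟨c', hc'⟩ := exists_eval_ne_zero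
    (mul_ne_zero hF0 (Finset.prod_ne_zero_iff.mpr fun p _ => N0 p))
  rw [map_mul, hF, map_prod] at hc'
  obtain ⟨p, hp, hpt⟩ := hh _ t (left_ne_zero_of_mul hc')
  have hpa : p ∈ J a c := by simpa [join] using hinit _ hp
  have hp1 : p ∈ J 1 (fun s => c' s.2) := by simpa [join] using hlast _ hp
  exact Finset.prod_ne_zero_iff.mp (right_ne_zero_of_mul hc') ⟨p, hpa, hpt⟩ (Finset.mem_univ _)
    (hN _ c' hp1)

theorem exists_generic_dim_stabilizes [Finite μ]
    (hdich : ∀ a T, GenericallyMisses (J a) T ∨ GenericallyCovers (J a) T)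
    (hinit : ∀ a c, J (a + 1) c ⊆ J a fun s => c (s.1.castSucc, s.2))
    (hlast : ∀ a c, J (a + 1) c ⊆ J 1 fun s => c (Fin.last a, s.2))
    (hdense : ∀ p ∈ persistent J, ∀ j, ∀ q : MvPolynomial (Fin j × κ) ℂ, q ≠ 0 →
      ∃ c, eval c q ≠ 0 ∧ p ∈ J j c) :
    ∃ d : ℕ → WithBot ℕ∞,
      (∀ a, Generically fun c => algDim (zariskiClosure (J a c)) = d a) ∧
      ∀ a, Xor (d (a + 1) < d a) (∀ j, a ≤ j → d j = d a) := by
  have := Fintype.ofFinite μ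
  choose d hd hk using fun a => exists_generic_algDim (hdich a)
  have hanti : Antitone d := antitone_nat_of_succ_le fun a =>
    withBot_enat_le_of_forall_natCast fun k hle => by
      obtain ⟨T, hTc, hT⟩ := (hk _ k).mp hle
      exact (hk _ k).mpr ⟨T, hTc, genericallyCovers_of_succ (hdich a T) (hinit a) hT⟩
  refine ⟨d, hd, fun a => ?_⟩
  rcases (hanti (Nat.le_succ a)).lt_or_eq with hlt | heq
  · exact .inl ⟨hlt, fun hall => hlt.ne (hall (a + 1) (Nat.le_succ a))⟩
  · refine .inr ⟨fun j haj => le_antisymm (hanti haj) ?_, heq.not_lt⟩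
    have hbound : ¬ ((Fintype.card μ + 1 : ℕ) : WithBot ℕ∞) ≤ d a := fun hle => by
      obtain ⟨T, hTc, -⟩ := (hk a _).mp hle
      have := Finset.card_le_univ T
      omega
    -- The finite fiber argument needs `k` to be the exact value of `d a`. If `d j` were smaller, no
    -- `k` would be exact and `d a` would exceed the number of parameters.
    have hstep : ∀ k : ℕ, (k : WithBot ℕ∞) ≤ d a → ¬ ((k + 1 : ℕ) : WithBot ℕ∞) ≤ d a →
        (k : WithBot ℕ∞) ≤ d j := fun k hle hnot => by
      obtain ⟨T, rfl, hT⟩ := (hk (a + 1) k).mp (heq.symm ▸ hle)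
      have hdom := dominates_persistent (hdich a) (hinit a) (hlast a)
        (fun T' hT' hcov => hnot ((hk a _).mpr ⟨T', hT', hcov⟩)) hT
      exact (hk j _).mpr ⟨T, rfl, genericallyCovers_of_dominates_persistent (hdich j T)
        (fun p hp => hdense p hp j) hdom⟩
    refine withBot_enat_le_of_forall_natCast fun k hle => ?_
    by_contra hnot
    have hall : ∀ i : ℕ, ((k + i : ℕ) : WithBot ℕ∞) ≤ d a := fun i => by
      induction i with
      | zero => exact hle
      | succ i ih =>
        by_contra hi
        refine hnot (le_trans ?_ (hstep _ ih hi))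
        exact_mod_cast Nat.le_add_right k i
    exact hbound (le_trans (by exact_mod_cast Nat.le_add_left _ k) (hall (Fintype.card μ + 1)))

end Family

/-! ### Algebraicity of the total solution space -/

/-- A function of `v` that is given by a polynomial. -/
def IsPolyFun {τ : Type} (F : (τ → ℂ) → ℂ) : Prop :=
  ∃ q : MvPolynomial τ ℂ, ∀ v, F v = eval v q

namespace IsPolyFun

variable {τ : Type} {F G : (τ → ℂ) → ℂ}

theorem const (a : ℂ) : IsPolyFun fun _ : τ → ℂ => a := ⟨C a, fun v => by simp⟩

theorem coord (i : τ) : IsPolyFun fun v : τ → ℂ => v i := ⟨X i, fun v => by simp⟩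

theorem add (hF : IsPolyFun F) (hG : IsPolyFun G) : IsPolyFun fun v => F v + G v := by
  obtain ⟨p, hp⟩ := hF
  obtain ⟨q, hq⟩ := hG
  exact ⟨p + q, fun v => by simp only [hp, hq, map_add]⟩

theorem sub (hF : IsPolyFun F) (hG : IsPolyFun G) : IsPolyFun fun v => F v - G v := by
  obtain ⟨p, hp⟩ := hF
  obtain ⟨q, hq⟩ := hG
  exact ⟨p - q, fun v => by simp only [hp, hq, map_sub]⟩

theorem mul (hF : IsPolyFun F) (hG : IsPolyFun G) : IsPolyFun fun v => F v * G v := by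
  obtain ⟨p, hp⟩ := hF
  obtain ⟨q, hq⟩ := hG
  exact ⟨p * q, fun v => by simp only [hp, hq, map_mul]⟩

theorem sum {ι : Type} {s : Finset ι} {F : ι → (τ → ℂ) → ℂ} (hF : ∀ i, IsPolyFun (F i)) :
    IsPolyFun fun v => ∑ i ∈ s, F i v := by
  choose q hq using hF
  exact ⟨∑ i ∈ s, q i, fun v => by rw [map_sum]; exact Finset.sum_congr rfl fun i _ => hq i v⟩

theorem eval {σ : Type} {F : σ → (τ → ℂ) → ℂ} (hF : ∀ i, IsPolyFun (F i))
    (p : MvPolynomial σ ℂ) : IsPolyFun fun v => MvPolynomial.eval (fun i => F i v) p := by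
  choose q hq using hF
  exact ⟨aeval q p, fun v => by rw [eval_aeval]; simp only [hq]⟩

end IsPolyFun

theorem isAlgebraicSet_of_isPolyFun {τ ι : Type} {F : ι → (τ → ℂ) → ℂ}
    (hF : ∀ i, IsPolyFun (F i)) : IsAlgebraicSet {v | ∀ i, F i v = 0} := by
  choose q hq using hF
  refine ⟨Ideal.span (Set.range q), ?_⟩
  rw [zeroLocus_span]
  ext v
  simp only [Set.mem_ofPred_eq, Set.forall_mem_range, hq]
  rfl

section System

variable {n m D r : ℕ} (f : Fin (n - D) → MvPolynomial (Fin n ⊕ Fin m) ℂ)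

theorem pderiv_slice (c : ConstIdx n D → ℂ) (k : Fin D) (l : Fin n) :
    pderiv (.inl l) (slice m c k) = C (sliceMatrix c k l) := by
  classical
  simp [slice, pderiv_X, Pi.single_apply]

theorem eval_atPoint (i : Fin r) (q : MvPolynomial (Fin n ⊕ Fin m) ℂ)
    (z : BlockIdx n r ⊕ Fin m → ℂ) :
    eval z (atPoint i q) = eval (fun s => z (Sum.map (fun l => (i, 0, l)) id s)) q := by
  rw [atPoint, eval_rename]
  rfl

variable {τ : Type} {c : (τ → ℂ) → ConstIdx n D → ℂ} {z : (τ → ℂ) → BlockIdx n r ⊕ Fin m → ℂ}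

theorem isPolyFun_eval_sliced (hc : ∀ s, IsPolyFun fun v => c v s)
    {y : (τ → ℂ) → Fin n ⊕ Fin m → ℂ} (hy : ∀ s, IsPolyFun fun v => y v s)
    (e : Fin (n - D) ⊕ Fin D) : IsPolyFun fun v => eval (y v) (sliced f (c v) e) := by
  rcases e with k | k
  · exact .eval hy _
  · simp only [sliced, Sum.elim_inr, slice, map_add, map_sum, map_mul, eval_C, eval_X]
    exact .add (.sum fun l => .mul (hc _) (hy _)) (hc _)

theorem isPolyFun_eval_pderiv_sliced (hc : ∀ s, IsPolyFun fun v => c v s)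
    {y : (τ → ℂ) → Fin n ⊕ Fin m → ℂ} (hy : ∀ s, IsPolyFun fun v => y v s)
    (e : Fin (n - D) ⊕ Fin D) (l : Fin n) :
    IsPolyFun fun v => eval (y v) (pderiv (.inl l) (sliced f (c v) e)) := by
  rcases e with k | k
  · simp only [sliced, Sum.elim_inl]
    exact IsPolyFun.eval hy _
  · simp only [sliced, Sum.elim_inr, pderiv_slice, eval_C]
    exact hc _

/-- The constants are coefficients in the system; Chevalley's theorem needs polynomiality in
constants, unknowns and parameters jointly. -/
theorem isPolyFun_componentSystem (hc : ∀ s, IsPolyFun fun v => c v s)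
    (hz : ∀ s, IsPolyFun fun v => z v s) (e : EqIdx n D r) :
    IsPolyFun fun v => eval (z v) (componentSystem r f (c v) e) := by
  have hy : ∀ i : Fin r, ∀ s, IsPolyFun fun v =>
      (fun s => z v (Sum.map (fun l => (i, 0, l)) id s)) s := fun i s => hz _
  rcases e with ⟨i, e⟩ | ⟨i, e⟩ | ⟨i, e⟩ | _
  · simp only [componentSystem, Sum.elim_inl, pointEqs, eval_atPoint]
    exact isPolyFun_eval_sliced f hc (hy i) e
  · simp only [componentSystem, Sum.elim_inl, Sum.elim_inr, firstOrderEqs, jacobianRow, vel,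
      map_sub, map_sum, map_mul, eval_atPoint, eval_X]
    refine .sub (.sum fun l => .mul (isPolyFun_eval_pderiv_sliced f hc (hy i) e l) (hz _)) ?_
    rcases e with k | k
    · simpa using .const 0
    · simpa using .const 1
  · simp only [componentSystem, Sum.elim_inl, Sum.elim_inr, secondOrderEqs, jacobianRow, acc,
      map_add, map_sum, map_mul, eval_atPoint, eval_X]
    refine .add (.sum fun l => .mul (isPolyFun_eval_pderiv_sliced f hc (hy i) e l) (hz _)) ?_
    rcases e with k | k
    · simp only [Sum.elim_inl, hessianForm, vel, map_sum, map_mul, eval_atPoint, eval_X]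
      exact .sum fun l => .sum fun l' => .mul (.mul (hz _) (.eval (hy i) _)) (hz _)
    · simpa using .const 0
  · simp only [componentSystem, Sum.elim_inr, traceEq, acc, map_sum, map_mul, eval_C, eval_X]
    exact .sum fun l => .mul (hc _) (.sum fun i => hz _)

theorem eval_fiberSystem {a : ℕ} (c : Fin a × ConstIdx n D → ℂ) (w : FiberIdx n m r a → ℂ)
    (j : Fin a) (e : EqIdx n D r) :
    eval w (fiberSystem r f c (j, e)) =
      eval (fun s => w (Sum.map (fun s => (j, s)) id s)) (componentSystem r f (constAt c j) e) := by
  rw [fiberSystem, eval_rename]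
  rfl

theorem isAlgebraicSet_fiberSolutions {A : Set (Fin n ⊕ Fin m → ℂ)} (hA : IsAlgebraicSet A)
    (a : ℕ) : IsAlgebraicSet {v : FamilyIdx n m D r a → ℂ |
      (fun s => v (.inr s)) ∈ fiberSolutions r f A fun s => v (.inl s)} := by
  obtain ⟨I, rfl⟩ := hA
  let F : (Fin a × EqIdx n D r) ⊕ (Fin a × Fin r × I) → (FamilyIdx n m D r a → ℂ) → ℂ :=
    Sum.elim
      (fun e v => eval (fun s => v (.inr s)) (fiberSystem r f (fun s => v (.inl s)) e))
      (fun e v => eval (fun s => v (.inr (Sum.map (fun l => (e.1, e.2.1, 0, l)) id s))) e.2.2.1)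
  have hF : ∀ e, IsPolyFun (F e) := by
    rintro (⟨j, e⟩ | ⟨j, i, q⟩)
    · simp only [F, Sum.elim_inl, eval_fiberSystem]
      exact isPolyFun_componentSystem f (fun s => .coord _) (fun s => .coord _) e
    · exact .eval (fun s => .coord _) _
  convert isAlgebraicSet_of_isPolyFun hF using 1
  ext v
  simp only [Set.mem_ofPred_eq, fiberSolutions, solutionSet, Sum.forall, F, Sum.elim_inl,
    Sum.elim_inr, Prod.forall, Subtype.forall]
  refine and_congr_right fun _ => forall_congr' fun j => forall_congr' fun i =>
    forall_congr' fun q => forall_congr' fun hq => ?_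
  change eval _ q = 0 ↔ _
  have : (Sum.elim (witness (fun s => v (.inr s)) j i) (toParam fun s => v (.inr s)) :
      Fin n ⊕ Fin m → ℂ) = fun s => v (.inr (Sum.map (fun l => (j, i, 0, l)) id s)) := by
    funext s
    cases s <;> rfl
  rw [this]

/-- The parameters of the solutions that are not ignored. -/
def paramSet (A : Set (Fin n ⊕ Fin m → ℂ)) (Δ : ∀ a : ℕ, Set (FamilyIdx n m D r a → ℂ)) (a : ℕ)
    (c : Fin a × ConstIdx n D → ℂ) : Set (Fin m → ℂ) :=
  toParam '' (fiberSolutions r f A c \ ignoredAt (Δ a) c)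

theorem paramSet_dichotomy {A : Set (Fin n ⊕ Fin m → ℂ)} (hA : IsAlgebraicSet A)
    {Δ : ∀ a : ℕ, Set (FamilyIdx n m D r a → ℂ)} (hΔ : ∀ a, IsAlgebraicSet (Δ a)) (a : ℕ)
    (T : Finset (Fin m)) :
    GenericallyMisses (paramSet f A Δ a) T ∨ GenericallyCovers (paramSet f A Δ a) T := by
  let φ : (Fin a × ConstIdx n D) ⊕ T → FamilyIdx n m D r a :=
    Sum.elim Sum.inl fun t => Sum.inr (Sum.inr t)
  rcases coordProj_dichotomy (isAlgebraicSet_fiberSolutions f hA a) (hΔ a) φ with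
    ⟨h, h0, hh⟩ | ⟨h, h0, hh⟩
  · refine .inl ⟨h, h0, ?_⟩
    rintro c _ ⟨w, hw, rfl⟩
    rw [← hh (Sum.elim c w) hw]
    congr 2
    funext s
    cases s <;> rfl
  · refine .inr ⟨h, h0, fun c t hct => ?_⟩
    obtain ⟨v, ⟨hv, hvΔ⟩, hvu⟩ := hh _ hct
    have hc : (fun s => v (.inl s)) = c := funext fun s => congrFun hvu (.inl s)
    refine ⟨_, ⟨fun s => v (.inr s), ⟨hc ▸ hv, fun hig => hvΔ ?_⟩, rfl⟩,
      funext fun s => congrFun hvu (.inr s)⟩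
    rw [← hc] at hig
    have hig' : (Sum.elim (fun s => v (.inl s)) fun s => v (.inr s)) ∈ Δ a := hig
    have : (Sum.elim (fun s => v (.inl s)) fun s => v (.inr s)) = v := by
      funext s
      cases s <;> rfl
    rwa [this] at hig'

end System

/-! ### Combining solutions over a persistent parameter -/

/-- Constants and solutions of several systems can be chosen generically and such that each system
avoids hypersurfaces determined by the solutions of the previous ones. -/
theorem exists_generic_family {κ Z : Type} (R : (κ → ℂ) → Z → Prop)
    (hR : ∀ q : MvPolynomial κ ℂ, q ≠ 0 → ∃ c z, eval c q ≠ 0 ∧ R c z)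
    (N : Z → MvPolynomial κ ℂ) (hN : ∀ z, N z ≠ 0) (j : ℕ) (q : MvPolynomial (Fin j × κ) ℂ)
    (hq : q ≠ 0) :
    ∃ (c : Fin j → κ → ℂ) (z : Fin j → Z), eval (fun s => c s.1 s.2) q ≠ 0 ∧
      (∀ i, R (c i) (z i)) ∧ ∀ i i', i < i' → eval (c i') (N (z i)) ≠ 0 := by
  induction j with
  | zero =>
    obtain ⟨v, hv⟩ := exists_eval_ne_zero hq
    refine ⟨fun i => i.elim0, fun i => i.elim0, ?_, fun i => i.elim0, fun i => i.elim0⟩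
    convert hv using 3
    exact Subsingleton.elim _ _
  | succ j ih =>
    obtain ⟨v, hv⟩ := exists_eval_ne_zero hq
    -- `F₁` freezes the last block at `v` to apply induction; `F₂` then freezes the blocks found and
    -- frees the last one.
    let F₁ : Fin (j + 1) × κ → MvPolynomial (Fin j × κ) ℂ := fun s =>
      Fin.snoc (α := fun _ => κ → MvPolynomial (Fin j × κ) ℂ) (fun i t => X (i, t))
        (fun t => C (v (Fin.last j, t))) s.1 s.2
    have hF₁ : ∀ c : Fin j × κ → ℂ, (fun s => eval c (F₁ s)) = fun s =>
        Fin.snoc (α := fun _ => κ → ℂ) (fun i t => c (i, t))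
          (fun t => v (Fin.last j, t)) s.1 s.2 := by
      intro c
      funext ⟨i, t⟩
      induction i using Fin.lastCases <;> simp [F₁]
    obtain ⟨c, z, hc, hcz, hcN⟩ := ih (aeval F₁ q) (by
      refine ne_zero_of_eval_ne_zero (v := fun s => v (s.1.castSucc, s.2)) ?_
      rw [eval_aeval, hF₁]
      convert hv using 3
      funext ⟨i, t⟩
      induction i using Fin.lastCases <;> simp)
    rw [eval_aeval, hF₁] at hc
    let F₂ : Fin (j + 1) × κ → MvPolynomial κ ℂ := fun s =>
      Fin.snoc (α := fun _ => κ → MvPolynomial κ ℂ) (fun i t => C (c i t)) (fun t => X t) s.1 s.2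
    have hF₂ : ∀ c' : κ → ℂ, (fun s => eval c' (F₂ s)) = fun s =>
        Fin.snoc (α := fun _ => κ → ℂ) c c' s.1 s.2 := by
      intro c'
      funext ⟨i, t⟩
      induction i using Fin.lastCases <;> simp [F₂]
    have hF₂q : aeval F₂ q ≠ 0 := by
      refine ne_zero_of_eval_ne_zero (v := fun t => v (Fin.last j, t)) ?_
      rw [eval_aeval, hF₂]
      exact hc
    obtain ⟨c', z', hc', hcz'⟩ := hR (aeval F₂ q * ∏ i, N (z i))
      (mul_ne_zero hF₂q (Finset.prod_ne_zero_iff.mpr fun i _ => hN (z i)))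
    rw [map_mul, map_prod, eval_aeval, hF₂] at hc'
    refine ⟨Fin.snoc c c', Fin.snoc z z', left_ne_zero_of_mul hc', fun i => ?_, fun i i' hii => ?_⟩
    · induction i using Fin.lastCases with
      | last => simpa using hcz'
      | cast i => simpa using hcz i
    · induction i using Fin.lastCases with
      | last => exact absurd hii (Fin.le_last i').not_gt
      | cast i =>
        induction i' using Fin.lastCases with
        | last =>
          simpa using Finset.prod_ne_zero_iff.mp (right_ne_zero_of_mul hc') i (Finset.mem_univ i)
        | cast i' => simpa using hcN i i' (by simpa using hii)

section System

variable {n m D r : ℕ} {f : Fin (n - D) → MvPolynomial (Fin n ⊕ Fin m) ℂ}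
  {A : Set (Fin n ⊕ Fin m → ℂ)} {Δ : ∀ a : ℕ, Set (FamilyIdx n m D r a → ℂ)}

theorem mem_fiberSolutions_iff {a : ℕ} {c : Fin a × ConstIdx n D → ℂ}
    {w : FiberIdx n m r a → ℂ} : w ∈ fiberSolutions r f A c ↔
      ∀ j, (∀ e, eval (fun s => w (Sum.map (fun s => (j, s)) id s))
          (componentSystem r f (constAt c j) e) = 0) ∧
        ∀ i, Sum.elim (witness w j i) (toParam w) ∈ A := by
  simp only [fiberSolutions, solutionSet, Set.mem_ofPred_eq, Prod.forall, eval_fiberSystem,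
    forall_and]

theorem selectFiber_mem_fiberSolutions {a b : ℕ} (e : Fin a ↪o Fin b)
    {c : Fin b × ConstIdx n D → ℂ} {w : FiberIdx n m r b → ℂ} (hw : w ∈ fiberSolutions r f A c) :
    selectFiber e w ∈ fiberSolutions r f A (selectConst e c) := by
  rw [mem_fiberSolutions_iff] at hw ⊢
  intro j
  refine ⟨fun q => ?_, (hw (e j)).2⟩
  convert (hw (e j)).1 q using 3
  · funext s
    cases s <;> rfl
  · rfl

theorem paramSet_subset_select (hΔ : IsIgnorable f A Δ) {a b : ℕ} (e : Fin a ↪o Fin b)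
    (c : Fin b × ConstIdx n D → ℂ) :
    paramSet f A Δ b c ⊆ paramSet f A Δ a (selectConst e c) := by
  rintro _ ⟨w, ⟨hw, hwΔ⟩, rfl⟩
  exact ⟨selectFiber e w, ⟨selectFiber_mem_fiberSolutions e hw,
    fun hig => hwΔ (hΔ.inclusion a b e c w hw hig)⟩, rfl⟩

/-- The first row of the slice at the point `x`, as a polynomial in the constants. -/
def sliceAt (hD : 0 < D) (x : Fin n → ℂ) : MvPolynomial (ConstIdx n D) ℂ :=
  ∑ l, X (.inl (⟨0, hD⟩, l)) * C (x l) + X (.inr (.inl ⟨0, hD⟩))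

theorem sliceAt_ne_zero (hD : 0 < D) (x : Fin n → ℂ) : sliceAt hD x ≠ 0 := by
  refine ne_zero_of_eval_ne_zero (v := Sum.elim (fun _ => 0) fun _ => 1) ?_
  simp [sliceAt]

theorem eval_sliceAt_witness (hD : 0 < D) {a : ℕ} {c : Fin a × ConstIdx n D → ℂ}
    {w : FiberIdx n m r a → ℂ} (hw : w ∈ fiberSolutions r f A c) (j : Fin a) (i : Fin r) :
    eval (constAt c j) (sliceAt hD (witness w j i)) = 0 := by
  have h := (mem_fiberSolutions_iff.mp hw j).1 (.inl (i, .inr ⟨0, hD⟩))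
  simp only [componentSystem, Sum.elim_inl, pointEqs, eval_atPoint, sliced, Sum.elim_inr, slice,
    map_add, map_sum, map_mul, eval_C, eval_X] at h
  simp only [sliceAt, map_add, map_sum, map_mul, eval_C, eval_X]
  exact h

/-- The product of the first rows of the slice at all witness points. -/
def avoidance (w : FiberIdx n m r 1 → ℂ) : MvPolynomial (ConstIdx n D) ℂ :=
  if hD : 0 < D then ∏ i, sliceAt hD (witness w 0 i) else 1

theorem avoidance_ne_zero (w : FiberIdx n m r 1 → ℂ) :
    (avoidance w : MvPolynomial (ConstIdx n D) ℂ) ≠ 0 := by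
  unfold avoidance
  split_ifs with hD
  · exact Finset.prod_ne_zero_iff.mpr fun i _ => sliceAt_ne_zero hD _
  · exact one_ne_zero

/-- Blocks not ignored individually are glued over `p`. For `D > 0`, the polynomial `avoidance`
makes every later slice miss the earlier witness points, so no coincidence arises; for `D = 0`
coincidences are not a reason to ignore a solution. -/
theorem dense_of_mem_persistent (hΔ : IsIgnorable f A Δ) {p : Fin m → ℂ}
    (hp : p ∈ persistent (paramSet f A Δ)) (j : ℕ) (q : MvPolynomial (Fin j × ConstIdx n D) ℂ)
    (hq : q ≠ 0) : ∃ c, eval c q ≠ 0 ∧ p ∈ paramSet f A Δ j c := by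
  rcases Nat.eq_zero_or_pos j with rfl | hj
  · obtain ⟨v, hv⟩ := exists_eval_ne_zero hq
    obtain ⟨c, -, hc⟩ := hp 1 one_ne_zero
    refine ⟨v, hv, ?_⟩
    rw [Subsingleton.elim v
      (selectConst (Fin.castLEOrderEmb (Nat.zero_le 1)) fun s : Fin 1 × ConstIdx n D => c s.2)]
    exact paramSet_subset_select hΔ _ _ hc
  let R : (ConstIdx n D → ℂ) → (FiberIdx n m r 1 → ℂ) → Prop := fun c w =>
    (w ∈ fiberSolutions r f A (fun s => c s.2) ∧ w ∉ ignoredAt (Δ 1) fun s => c s.2) ∧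
      toParam w = p
  have hR : ∀ q : MvPolynomial (ConstIdx n D) ℂ, q ≠ 0 → ∃ c w, eval c q ≠ 0 ∧ R c w := by
    intro q hq
    obtain ⟨c, hc, w, hw, hwp⟩ := hp q hq
    exact ⟨c, w, hc, hw, hwp⟩
  obtain ⟨c, z, hc, hcz, hcN⟩ := exists_generic_family R hR avoidance avoidance_ne_zero j q hq
  refine ⟨_, hc, ?_⟩
  set c' : Fin j × ConstIdx n D → ℂ := fun s => c s.1 s.2 with hc'
  let w : FiberIdx n m r j → ℂ := Sum.elim (fun s => z s.1 (.inl (0, s.2))) p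
  have hblock : ∀ i, selectFiber (single i) w = z i := by
    intro i
    funext s
    rcases s with ⟨k, s⟩ | s
    · rw [Subsingleton.elim k 0]
      rfl
    · exact (congrFun (hcz i).2 s).symm
  have hw : w ∈ fiberSolutions r f A c' := by
    rw [mem_fiberSolutions_iff]
    intro i
    have h := mem_fiberSolutions_iff.mp (hcz i).1.1 0
    rw [← hblock i] at h
    refine ⟨fun e => ?_, h.2⟩
    convert h.1 e using 3
    · funext s
      cases s <;> rfl
    · rfl
  refine ⟨w, ⟨hw, fun hig => ?_⟩, rfl⟩
  -- The consistency condition applies from two systems on; for one system the glued point is `z 0`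
  -- itself.
  rcases Nat.lt_or_eq_of_le hj with hj | rfl
  · rcases hΔ.consistent j hj c' w hw hig with ⟨i, hi⟩ | ⟨hD, i, i', hne, k, k', hk⟩
    · rw [hblock i] at hi
      exact (hcz i).1.2 hi
    -- A later witness point lies on its own slice, while the earlier points were kept off the
    -- slice's first hyperplane.
    · have key : ∀ {i i' : Fin j} {k k' : Fin r}, i < i' → witness w i k ≠ witness w i' k' := by
        intro i i' k k' hlt hk
        have h := hcN i i' hlt
        rw [avoidance, dif_pos hD, map_prod, Finset.prod_ne_zero_iff] at h
        refine h k (Finset.mem_univ k) ?_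
        have h0 := eval_sliceAt_witness hD hw i' k'
        rw [← hk] at h0
        exact h0
      rcases hne.lt_or_gt with hlt | hlt
      · exact key hlt hk
      · exact key hlt hk.symm
  · refine (hcz 0).1.2 ?_
    have hw0 : w = z 0 := by
      rw [← hblock 0]
      funext s
      rcases s with ⟨i, s⟩ | s
      · rw [Subsingleton.elim i 0]
        rfl
      · rfl
    have hc0 : c' = fun s => c 0 s.2 := by
      funext ⟨i, s⟩
      rw [Subsingleton.elim i 0]
    rwa [← hw0, ← hc0]

end System

end TraceTest

end

theorem corollary5 {n m D r : ℕ} (hD : D ≤ n) (hr : 1 ≤ r)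
    (f : Fin (n - D) → MvPolynomial (Fin n ⊕ Fin m) ℂ)
    (A : Set (Fin n ⊕ Fin m → ℂ)) (hA : TraceTest.IsIrreducibleAlgebraicSet A)
    (hAf : A ⊆ TraceTest.solutionSet f)
    (Δ : ∀ a : ℕ, Set (TraceTest.FamilyIdx n m D r a → ℂ))
    (hΔ : TraceTest.IsIgnorable f A Δ) :
    ∃ d : ℕ → WithBot ℕ∞,
      (∀ a, TraceTest.Generically
        fun c : Fin a × TraceTest.ConstIdx n D → ℂ => TraceTest.paramDim f A Δ a c = d a) ∧
      ∀ a, Xor (d (a + 1) < d a) (∀ j, a ≤ j → d j = d a) :=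
  TraceTest.exists_generic_dim_stabilizes (J := TraceTest.paramSet f A Δ)
    (fun a T => TraceTest.paramSet_dichotomy f hA.1 hΔ.algebraic a T)
    (fun _ c => TraceTest.paramSet_subset_select hΔ Fin.castSuccOrderEmb c)
    (fun a c => TraceTest.paramSet_subset_select hΔ (TraceTest.single (Fin.last a)) c)
    (fun _ hp j q hq => TraceTest.dense_of_mem_persistent hΔ hp j q hq)
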